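/- Let $\mathbb{K}$ be a field of characteristic $0$, let $n\ge 1$, and let $e_1,\dots,e_n$ be the standard basis of $V=\mathbb{K}^n$. Put $$\det\nolimits_n=\sum_{\sigma\in\mathfrak{S}_n}\operatorname{sgn}(\sigma)\,e_{\sigma(1)}\otimes\cdots\otimes e_{\sigma(n)},\qquad \operatorname{perm}_n=\sum_{\sigma\in\mathfrak{S}_n}e_{\sigma(1)}\otimes\cdots\otimes e_{\sigma(n)}$$ in $V^{\otimes n}$. For $T\in V^{\otimes n}$ let the tensor rank $\mathbf{R}(T)$ be the least $k$ such that $T$ is a sum of $k$ tensors of the form $v_1\otimes\cdots\otimes v_n$, and let the border rank $\underline{\mathbf{R}}(T)$ be the least $k$ such that $T$ lies in the Zariski closure of $\{S\in V^{\otimes n} : \mathbf{R}(S)\le k\}$, that is, every polynomial function on $V^{\otimes n}$ with coefficients in $\mathbb{K}$ that vanishes on this set vanishes at $T$. Then $$\underline{\mathbf{R}}(\det\nolimits_n)\ \ge\ \frac{n^{n-1}}{(n-1)!}.$$ Moreover, for every $n\ge 3$, $$\mathbf{R}(\operatorname{perm}_n)\le 2^{n-1}<\frac{n^{n-1}}{(n-1)!}\le\underline{\mathbf{R}}(\det\nolimits_n)\le\mathbf{R}(\det\nolimits_n),$$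 so that $\mathbf{R}(\operatorname{perm}_n)<\mathbf{R}(\det_n)$. -/

import Mathlib

open scoped TensorProduct Nat

noncomputable section

namespace TensorRank

variable {K : Type*} [Field K]

/-- The Zariski closure of a subset `Z` of a vector space `W`: the common zeros of all polynomial
functions on `W` that vanish on `Z`. A polynomial function is a polynomial expression, with
coefficients in `K`, in linear forms on `W`. -/
def zariskiClosure {W : Type*} [AddCommGroup W] [Module K W] (Z : Set W) : Set W :=
  {w | ∀ p : MvPolynomial (Module.Dual K W) K,
    (∀ z ∈ Z, MvPolynomial.eval (fun f : Module.Dual K W => f z) p = 0) →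
      MvPolynomial.eval (fun f : Module.Dual K W => f w) p = 0}

variable {d : ℕ} {V : Fin d → Type*} [∀ j, AddCommGroup (V j)] [∀ j, Module K (V j)]

/-- `T` is a sum of `k` tensors of the form `v₁ ⊗ ⋯ ⊗ v_d`. -/
def IsSumOfDecomposables (T : ⨂[K] j, V j) (k : ℕ) : Prop :=
  ∃ v : Fin k → (j : Fin d) → V j, T = ∑ i, PiTensorProduct.tprod K (v i)

/-- The tensor rank of `T`: the least `k` such that `T` is a sum of `k` decomposable tensors
(such a `k` exists when `d` is positive, see `exists_isSumOfDecomposables`). -/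
def tensorRank (T : ⨂[K] j, V j) : ℕ :=
  sInf {k | IsSumOfDecomposables T k}

/-- The border rank of `T`: the least `k` such that `T` lies in the Zariski closure of the set of
tensors of rank at most `k`. -/
def borderRank (T : ⨂[K] j, V j) : ℕ :=
  sInf {k | T ∈ zariskiClosure (K := K) {S : ⨂[K] j, V j | tensorRank S ≤ k}}

/-- The minimum in the definition of the tensor rank is over a nonempty set. -/
theorem exists_isSumOfDecomposables (hd : 1 ≤ d) (T : ⨂[K] j, V j) :
    ∃ k, IsSumOfDecomposables T k := by
  induction T using PiTensorProduct.induction_on with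
  | smul_tprod r f =>
    refine ⟨1, fun _ => Function.update f ⟨0, hd⟩ (r • f ⟨0, hd⟩), ?_⟩
    simp
  | add x y hx hy =>
    obtain ⟨k, v, rfl⟩ := hx
    obtain ⟨l, w, rfl⟩ := hy
    exact ⟨k + l, Fin.append v w, by simp [Fin.sum_univ_add]⟩

/-- The minimum in the definition of the border rank is over a nonempty set. -/
theorem exists_mem_zariskiClosure (T : ⨂[K] j, V j) :
    ∃ k, T ∈ zariskiClosure (K := K) {S : ⨂[K] j, V j | tensorRank S ≤ k} :=
  ⟨tensorRank T, fun _ hp => hp T (le_refl (tensorRank T))⟩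

variable (K)

/-- The determinant tensor `∑_σ sgn(σ) e_{σ(1)} ⊗ ⋯ ⊗ e_{σ(n)}` in `(Kⁿ)^{⊗ n}`. -/
def detTensor (n : ℕ) : ⨂[K] _j : Fin n, (Fin n → K) :=
  ∑ σ : Equiv.Perm (Fin n), ((Equiv.Perm.sign σ : ℤ) : K) •
    PiTensorProduct.tprod K (fun j : Fin n => (Pi.single (σ j) 1 : Fin n → K))

/-- The permanent tensor `∑_σ e_{σ(1)} ⊗ ⋯ ⊗ e_{σ(n)}` in `(Kⁿ)^{⊗ n}`. -/
def permTensor (n : ℕ) : ⨂[K] _j : Fin n, (Fin n → K) :=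
  ∑ σ : Equiv.Perm (Fin n),
    PiTensorProduct.tprod K (fun j : Fin n => (Pi.single (σ j) 1 : Fin n → K))

end TensorRank

end

/-! Let v₁ ⊗ ⋯ ⊗ vₙ act on ⋀ⁿV ⊗ ⋀ⁿ⁻¹V ⊗ ⋯ ⊗ ⋀¹V by contracting the p-th factor with v_p.
Contraction of ⋀ᵏV with a nonzero vector has rank C(n-1, k-1), which is k/n of the dimension C(n,
k). So a decomposable tensor acts with rank at most n!/nⁿ of the total dimension
(`finrank_map_koszulFlattening_tprod_le`). If det_n acts injectively, it needs at least nⁿ/n! =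
nⁿ⁻¹/(n-1)! summands. Injectivity is a Zariski open condition
(`exists_injective_of_mem_zariskiClosure`), so the bound holds for border rank too.

For injectivity (`eq_zero_of_koszulFlattening_detTensor`), the exterior powers are rows of fermions
and an empty row 0 is adjoined. Contracting with det_n and then filling row 0 is, up to sign, the
product over p of the operators moving one particle from row p to row 0 (`prod_rowMove_eq`). Each is
an sl₂ raising operator, hence injective on negative weights. The shortest row gives first, so row 0
always holds fewer particles than the row it takes from.

For the permanent, Glynn's formula (`two_pow_smul_permTensor`) uses 2ⁿ⁻¹ decomposable tensors, and
2ⁿ⁻¹(n-1)! < nⁿ⁻¹ once n ≥ 3. -/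

noncomputable section

namespace TensorRank

/-! ### Canonical anticommutation relations on Fock space -/

section Fock

variable {I : Type*} [LinearOrder I]

/-- The sign picked up by a fermionic operator at site `i` passing the occupied sites of `S`
below `i`. -/
def fockSign (K : Type*) [Field K] (i : I) (S : Finset I) : K :=
  (-1) ^ (S.filter (· < i)).card

variable {K : Type*} [Field K]

theorem fockSign_mul_self (i : I) (S : Finset I) : fockSign K i S * fockSign K i S = 1 := by
  rw [fockSign, ← mul_pow]; simp

theorem fockSign_insert {i j : I} {S : Finset I} (hj : j ∉ S) :
    fockSign K i (insert j S) = (if j < i then -1 else 1) * fockSign K i S := by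
  unfold fockSign
  rw [Finset.filter_insert]
  split_ifs with h
  · rw [Finset.card_insert_of_notMem (by simp [hj]), pow_succ]; ring
  · simp

theorem fockSign_erase {i j : I} {S : Finset I} (hj : j ∈ S) :
    fockSign K i (S.erase j) = (if j < i then -1 else 1) * fockSign K i S := by
  have h := fockSign_insert (K := K) (i := i) (Finset.notMem_erase j S)
  rw [Finset.insert_erase hj] at h
  rw [h]
  split_ifs <;> ring

variable (K)

/-- The creation operator at site `i` on the fermionic Fock space `Finset I → K`. -/
def create (i : I) : Module.End K (Finset I → K) where
  toFun x S := if i ∈ S then fockSign K i S * x (S.erase i) else 0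
  map_add' x y := by ext S; simp only [Pi.add_apply]; split_ifs <;> ring
  map_smul' r x := by
    ext S; simp only [Pi.smul_apply, smul_eq_mul, RingHom.id_apply]; split_ifs <;> ring

/-- The annihilation operator at site `i` on the fermionic Fock space `Finset I → K`. -/
def annih (i : I) : Module.End K (Finset I → K) where
  toFun x S := if i ∈ S then 0 else fockSign K i S * x (insert i S)
  map_add' x y := by ext S; simp only [Pi.add_apply]; split_ifs <;> ring
  map_smul' r x := by
    ext S; simp only [Pi.smul_apply, smul_eq_mul, RingHom.id_apply]; split_ifs <;> ring

variable {K}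

theorem create_apply (i : I) (x : Finset I → K) (S : Finset I) :
    create K i x S = if i ∈ S then fockSign K i S * x (S.erase i) else 0 := rfl

theorem annih_apply (i : I) (x : Finset I → K) (S : Finset I) :
    annih K i x S = if i ∈ S then 0 else fockSign K i S * x (insert i S) := rfl

/-- For distinct sites exactly one lies below the other, so exchanging the operators flips exactly
one sign. For equal sites both sides vanish. -/
theorem create_mul_create (i j : I) :
    create K i * create K j = -(create K j * create K i) := by
  refine LinearMap.ext fun x => funext fun S => ?_
  simp only [Module.End.mul_apply, LinearMap.neg_apply, Pi.neg_apply, create_apply,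
    Finset.mem_erase]
  rcases eq_or_ne i j with rfl | hij
  · simp
  by_cases hi : i ∈ S <;> by_cases hj : j ∈ S <;> simp only [hi, hj, hij, hij.symm, ne_eq,
    not_false_eq_true, and_self, and_false, if_true, if_false, mul_zero, neg_zero]
  rw [fockSign_erase hi, fockSign_erase hj, Finset.erase_right_comm]
  rcases lt_or_gt_of_ne hij with h | h <;> simp only [h, h.not_gt, if_true, if_false] <;> ring

theorem annih_mul_annih (i j : I) :
    annih K i * annih K j = -(annih K j * annih K i) := by
  refine LinearMap.ext fun x => funext fun S => ?_
  simp only [Module.End.mul_apply, LinearMap.neg_apply, Pi.neg_apply, annih_apply,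
    Finset.mem_insert]
  rcases eq_or_ne i j with rfl | hij
  · simp
  by_cases hi : i ∈ S <;> by_cases hj : j ∈ S <;> simp only [hi, hj, hij, hij.symm,
    or_self, or_true, if_true, if_false, mul_zero, neg_zero]
  rw [fockSign_insert hi, fockSign_insert hj, Finset.insert_comm]
  rcases lt_or_gt_of_ne hij with h | h <;> simp only [h, h.not_gt, if_true, if_false] <;> ring

theorem annih_mul_create (i j : I) :
    annih K i * create K j = (if i = j then 1 else 0) - create K j * annih K i := by
  refine LinearMap.ext fun x => funext fun S => ?_
  rcases eq_or_ne i j with rfl | hij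
  · by_cases hi : i ∈ S
    · simp [annih_apply, create_apply, hi, fockSign_erase hi, ← mul_assoc, fockSign_mul_self]
    · simp [annih_apply, create_apply, hi, fockSign_insert hi, ← mul_assoc, fockSign_mul_self]
  · simp only [hij, if_false, LinearMap.sub_apply, LinearMap.zero_apply, Module.End.mul_apply,
      Pi.sub_apply, Pi.zero_apply, annih_apply, create_apply, Finset.mem_insert, Finset.mem_erase]
    by_cases hi : i ∈ S <;> by_cases hj : j ∈ S <;> simp only [hi, hj, hij, hij.symm, ne_eq,
      not_false_eq_true, and_self, and_false, or_true, or_self, if_true, if_false, mul_zero,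
      sub_zero]
    rw [fockSign_insert hi, fockSign_erase hj, Finset.erase_insert_of_ne hij]
    rcases lt_or_gt_of_ne hij with h | h <;> simp only [h, h.not_gt, if_true, if_false] <;> ring

theorem bilinear_commutator {A : Type*} [Ring A] {c₁ c₂ a₁ a₂ δ ε : A}
    (hc : c₁ * c₂ = -(c₂ * c₁)) (ha : a₁ * a₂ = -(a₂ * a₁))
    (h₁ : a₁ * c₂ = δ - c₂ * a₁) (h₂ : a₂ * c₁ = ε - c₁ * a₂) :
    (c₁ * a₁) * (c₂ * a₂) = (c₂ * a₂) * (c₁ * a₁) + c₁ * δ * a₂ - c₂ * ε * a₁ := by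
  have h : c₁ * c₂ * (a₁ * a₂) = c₂ * c₁ * (a₂ * a₁) := by rw [hc, ha]; noncomm_ring
  calc (c₁ * a₁) * (c₂ * a₂) = c₁ * (a₁ * c₂) * a₂ := by noncomm_ring
    _ = c₁ * δ * a₂ - c₁ * c₂ * (a₁ * a₂) := by rw [h₁]; noncomm_ring
    _ = c₂ * (ε - c₁ * a₂) * a₁ + c₁ * δ * a₂ - c₂ * ε * a₁ := by rw [h]; noncomm_ring
    _ = _ := by rw [← h₂]; noncomm_ring

/-- These are the relations of the matrix units of gl(I): two sign changes cancel in each passage,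
leaving only the contraction terms. -/
theorem create_mul_annih_commutator (i j k l : I) :
    (create K i * annih K j) * (create K k * annih K l) =
      (create K k * annih K l) * (create K i * annih K j) +
      (if j = k then create K i * annih K l else 0) -
      (if l = i then create K k * annih K j else 0) := by
  rw [bilinear_commutator (create_mul_create i k) (annih_mul_annih j l) (annih_mul_create j k)
    (annih_mul_create l i)]
  split_ifs <;> simp

theorem create_mul_annih_self_apply (i : I) (x : Finset I → K) (S : Finset I) :
    (create K i * annih K i) x S = if i ∈ S then x S else 0 := by
  rw [Module.End.mul_apply, create_apply, annih_apply]
  by_cases hi : i ∈ S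
  · simp [hi, fockSign_erase hi, ← mul_assoc, fockSign_mul_self]
  · simp [hi]

theorem create_apply_eq_zero_iff (i : I) (x : Finset I → K) :
    create K i x = 0 ↔ ∀ S, i ∉ S → x S = 0 := by
  constructor
  · intro h S hS
    have := congrFun h (insert i S)
    rw [create_apply] at this
    simpa [hS, fockSign] using this
  · intro h
    ext S
    rw [create_apply]
    split_ifs with hi
    · rw [h _ (Finset.notMem_erase i S), mul_zero]; rfl
    · rfl

end Fock

/-! ### Raising operators on negative sl₂ weights -/

section Sl2

attribute [local instance] LieRing.ofAssociativeRing

/-- A nonzero `x` would be a primitive vector of weight a - b < 0 for the triple (k - l, e, f), but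
finite dimension forces such weights to be natural numbers. -/
theorem eq_zero_of_raising_eq_zero {K M : Type*} [Field K] [CharZero K] [AddCommGroup M]
    [Module K M] [FiniteDimensional K M] {e f k l : Module.End K M} {a b : ℕ} (hab : a < b) {x : M}
    (hk : k x = (a : K) • x) (hl : l x = (b : K) • x) (hx : e x = 0)
    (hef : e * f = f * e + k - l) (hke : k * e = e * k + e) (hle : l * e = e * l - e)
    (hkf : k * f = f * k - f) (hlf : l * f = f * l + f) : x = 0 := by
  by_contra hne
  have hh : (k - l) x = ((a : K) - b) • x := by
    rw [LinearMap.sub_apply, hk, hl, sub_smul]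
  have hab' : (a : K) - b ≠ 0 := sub_ne_zero.2 (by exact_mod_cast hab.ne)
  have t : IsSl2Triple (k - l) e f := by
    refine ⟨fun h0 => ?_, ?_, ?_, ?_⟩
    · rw [h0, LinearMap.zero_apply] at hh
      exact (smul_ne_zero hab' hne) hh.symm
    · rw [Ring.lie_def, hef]
      abel
    · rw [Ring.lie_def, sub_mul, mul_sub, hke, hle]
      abel
    · rw [Ring.lie_def, sub_mul, mul_sub, hkf, hlf]
      abel
  have P : t.HasPrimitiveVectorWith x ((a : K) - b) := ⟨hne, hh, hx⟩
  obtain ⟨m, hm⟩ := P.exists_nat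
  have : a = m + b := by
    have : (a : K) = m + b := by rw [← hm]; ring
    exact_mod_cast this
  omega

end Sl2

/-! ### The gl action on the rows of an array -/

section Rows

variable (K : Type*) [Field K] {R C : Type*} [LinearOrder R] [LinearOrder C] [Fintype C]

/-- The operator moving a particle from row `q` to row `p`, on the Fock space with sites the cells
of an array; for `p = q` it counts the particles in row `p`. -/
def rowMove (p q : R) : Module.End K (Finset (R ×ₗ C) → K) :=
  ∑ i : C, create K (toLex (p, i)) * annih K (toLex (q, i))

variable {K}

theorem rowMove_commutator (p q r s : R) :
    rowMove K (C := C) p q * rowMove K r s = rowMove K r s * rowMove K p q +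
      (if q = r then rowMove K p s else 0) - (if s = p then rowMove K r q else 0) := by
  simp only [rowMove, Finset.sum_mul_sum]
  rw [Finset.sum_comm (f := fun i j => create K (toLex (r, i)) * annih K (toLex (s, i)) *
    (create K (toLex (p, j)) * annih K (toLex (q, j))))]
  simp only [create_mul_annih_commutator (toLex (p, _)), Finset.sum_add_distrib,
    Finset.sum_sub_distrib]
  congr 1
  · congr 1
    split_ifs with h <;> simp [h]
  · split_ifs with h <;> simp [h]

theorem rowMove_self_mul_create_mul_annih (p q : R) (i j : C) :
    rowMove K q q * (create K (toLex (p, i)) * annih K (toLex (p, j))) =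
      create K (toLex (p, i)) * annih K (toLex (p, j)) * rowMove K q q := by
  simp only [rowMove, Finset.sum_mul, Finset.mul_sum, create_mul_annih_commutator (toLex (q, _)),
    Finset.sum_add_distrib, Finset.sum_sub_distrib]
  rcases eq_or_ne q p with rfl | h
  · simp
  · simp [h, h.symm]

theorem rowMove_self_apply (p : R) (x : Finset (R ×ₗ C) → K) (S : Finset (R ×ₗ C)) :
    rowMove K p p x S = ((Finset.univ.filter fun i : C => toLex (p, i) ∈ S).card : K) * x S := by
  simp only [rowMove, LinearMap.sum_apply, Finset.sum_apply, create_mul_annih_self_apply]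
  rw [← Finset.sum_filter, Finset.sum_const, nsmul_eq_mul]

theorem eq_zero_of_rowMove_eq_zero [CharZero K] [Finite R] {p q : R} (hpq : p ≠ q) {a b : ℕ}
    (hab : a < b) {x : Finset (R ×ₗ C) → K} (hp : rowMove K p p x = (a : K) • x)
    (hq : rowMove K q q x = (b : K) • x) (hx : rowMove K p q x = 0) : x = 0 := by
  have := Fintype.ofFinite R
  refine eq_zero_of_raising_eq_zero (f := rowMove K q p) hab hp hq hx ?_ ?_ ?_ ?_ ?_ <;>
    rw [rowMove_commutator] <;> simp [hpq, hpq.symm]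

end Rows

/-! ### Ordered products of anticommuting elements -/

section RingProducts

variable {A : Type*} [Ring A]

theorem units_smul_mul (K : Type*) [CommRing K] [Algebra K A] (u : ℤˣ) (x y : A) :
    (u • x) * y = ((u : ℤ) : K) • (x * y) := by
  rcases Int.units_eq_one_or u with rfl | rfl <;> simp

theorem commute_mul_of_anticommute {c a z : A} (hc : c * z = -(z * c)) (ha : a * z = -(z * a)) :
    Commute (c * a) z := by
  rw [Commute, SemiconjBy, mul_assoc, ha, mul_neg, ← mul_assoc, hc, neg_mul, neg_neg, mul_assoc]

theorem mul_self_eq_zero_of_anticommute (K : Type*) [Field K] [CharZero K] [Algebra K A] {z : A}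
    (h : z * z = -(z * z)) : z * z = 0 := by
  have h2 : (2 : K) • (z * z) = 0 := by
    rw [two_smul]
    nth_rewrite 1 [h]
    exact neg_add_cancel _
  exact (smul_eq_zero.1 h2).resolve_left two_ne_zero

theorem mul_mul_self_of_anticommutator {K : Type*} [CommRing K] [Algebra K A] {a c : A} {t : K}
    (h : a * c = t • (1 : A) - c * a) (ha : a * a = 0) : a * (c * a) = t • a := by
  rw [← mul_assoc, h, sub_mul, mul_assoc, ha, mul_zero, sub_zero, smul_mul_assoc, one_mul]

theorem mul_prod_ofFn_of_anticommute {n : ℕ} (z : A) (c : Fin n → A)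
    (h : ∀ i, z * c i = -(c i * z)) :
    z * (List.ofFn c).prod = (-1) ^ n * ((List.ofFn c).prod * z) := by
  induction n with
  | zero => simp
  | succ n ih =>
    rw [List.ofFn_succ, List.prod_cons, ← mul_assoc, h 0, neg_mul, mul_assoc,
      ih (fun i => c i.succ) fun i => h i.succ, pow_succ]
    rcases neg_one_pow_eq_or A n with h | h <;> rw [h] <;> noncomm_ring

/-- Sorting the `c`s to the left moves each `a i` past every `c j` with i < j, one sign per pair. -/
theorem prod_ofFn_mul {n : ℕ} (c a : Fin n → A) (h : ∀ i j, a i * c j = -(c j * a i)) :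
    (List.ofFn fun i => c i * a i).prod =
      (-1) ^ (n.choose 2) * ((List.ofFn c).prod * (List.ofFn a).prod) := by
  induction n with
  | zero => simp
  | succ n ih =>
    have e : (n + 1).choose 2 = n + n.choose 2 := by
      rw [Nat.choose_succ_succ' n 1, Nat.choose_one_right]
    have h0 := mul_prod_ofFn_of_anticommute (a 0) (fun i => c i.succ) fun i => h 0 i.succ
    rw [List.ofFn_succ, List.prod_cons, ih (fun i => c i.succ) (fun i => a i.succ)
      fun i j => h i.succ j.succ, List.ofFn_succ, List.prod_cons, List.ofFn_succ, List.prod_cons,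
      e, pow_add]
    generalize (List.ofFn fun i => c i.succ).prod = P at *
    generalize (List.ofFn fun i => a i.succ).prod = Q at *
    have h1 : c 0 * P * (a 0 * Q) = c 0 * (P * a 0) * Q := by noncomm_ring
    rcases neg_one_pow_eq_or A n with h | h <;>
      rcases neg_one_pow_eq_or A (n.choose 2) with h' | h' <;> rw [h] at h0 <;>
      rw [h1, h, h']
    · rw [one_mul] at h0; rw [← h0]; noncomm_ring
    · rw [one_mul] at h0; rw [← h0]; noncomm_ring
    · rw [neg_mul, one_mul, eq_comm, neg_eq_iff_eq_neg] at h0; rw [h0]; noncomm_ring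
    · rw [neg_mul, one_mul, eq_comm, neg_eq_iff_eq_neg] at h0; rw [h0]; noncomm_ring

theorem prod_ofFn_mul_prod_ofFn {K : Type*} [CommRing K] [Algebra K A] {n : ℕ} (c a : Fin n → A)
    (t : Fin n → K) (h : ∀ i j, i ≠ j → Commute (c i * a i) (a j))
    (ht : ∀ i, a i * (c i * a i) = t i • a i) :
    (List.ofFn a).prod * (List.ofFn fun i => c i * a i).prod = (∏ i, t i) • (List.ofFn a).prod := by
  induction n with
  | zero => simp
  | succ n ih =>
    have hc : Commute (c 0 * a 0) (List.ofFn fun i => a (Fin.succ i)).prod := by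
      refine Commute.list_prod_right _ _ fun x hx => ?_
      obtain ⟨i, rfl⟩ := (List.mem_ofFn' _ _).1 hx
      exact h 0 i.succ (Fin.succ_ne_zero i).symm
    rw [List.ofFn_succ, List.prod_cons, List.ofFn_succ, List.prod_cons, mul_assoc,
      ← mul_assoc (List.prod _), ← hc.eq, mul_assoc (c 0 * a 0),
      ih _ _ (fun i => t i.succ) (fun i j hij => h _ _ (by simpa using hij)) fun i => ht _,
      ← mul_assoc, ht, Fin.prod_univ_succ, smul_mul_smul_comm]

theorem mul_list_prod_eq_zero (z : A) (l : List A) (h : ∀ y ∈ l, Commute z y ∨ z * y = 0)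
    (h0 : ∃ y ∈ l, z * y = 0) : z * l.prod = 0 := by
  induction l with
  | nil => simp at h0
  | cons y l ih =>
    rw [List.prod_cons, ← mul_assoc]
    rcases h y (by simp) with hy | hy
    · obtain ⟨w, hw, hzw⟩ := h0
      rcases List.mem_cons.1 hw with rfl | hw
      · rw [hzw, zero_mul]
      · rw [hy.eq, mul_assoc, ih (fun y hy => h y (List.mem_cons_of_mem _ hy)) ⟨w, hw, hzw⟩,
          mul_zero]
    · rw [hy, zero_mul]

/-- The product of a family of anticommuting elements, as an alternating map in the
coefficients. -/
theorem exists_alternatingMap_prod {K : Type*} [Field K] [CharZero K] [Algebra K A] {n : ℕ}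
    (c : Fin n → A) (h : ∀ i j, c i * c j = -(c j * c i)) :
    ∃ f : (Fin n → K) [⋀^Fin n]→ₗ[K] A,
      ∀ r : Fin n → Fin n, f (fun p => Pi.single (r p) 1) = (List.ofFn fun p => c (r p)).prod := by
  let L : (Fin n → K) →ₗ[K] A := Fintype.linearCombination K c
  have hL (m : Fin n → K) : L m * L m = 0 := by
    refine mul_self_eq_zero_of_anticommute K ?_
    simp only [L, Fintype.linearCombination_apply, Finset.sum_mul_sum]
    nth_rewrite 2 [Finset.sum_comm]
    rw [← Finset.sum_neg_distrib]
    refine Finset.sum_congr rfl fun i _ => ?_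
    rw [← Finset.sum_neg_distrib]
    refine Finset.sum_congr rfl fun j _ => ?_
    rw [smul_mul_smul_comm, smul_mul_smul_comm, h i j, smul_neg, mul_comm (m i)]
  refine ⟨(ExteriorAlgebra.lift K ⟨L, hL⟩).toLinearMap.compAlternatingMap
    (ExteriorAlgebra.ιMulti K n), fun r => ?_⟩
  rw [LinearMap.compAlternatingMap_apply, ExteriorAlgebra.ιMulti_apply, AlgHom.toLinearMap_apply,
    map_list_prod, List.map_ofFn]
  congr 2
  funext p
  simp [L, Fintype.linearCombination_apply_single]

end RingProducts

theorem sum_perm_eq_sum_of_not_bijective {ι M : Type*} [Fintype ι] [DecidableEq ι]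
    [AddCommMonoid M] (g : (ι → ι) → M) (hg : ∀ r, ¬ Function.Bijective r → g r = 0) :
    ∑ r, g r = ∑ σ : Equiv.Perm ι, g σ := by
  refine (Finset.sum_of_injOn (fun σ : Equiv.Perm ι => (σ : ι → ι))
    (fun σ _ τ _ h => DFunLike.coe_injective h) (by simp [Set.MapsTo]) (fun r _ hr => hg r ?_)
    fun σ _ => rfl).symm
  exact fun hb => hr ⟨Equiv.ofBijective r hb, by simp, rfl⟩

theorem apply_prod_ofFn_of_commutator {K M : Type*} [Field K] [AddCommGroup M] [Module K M]
    {m : ℕ} (N : Module.End K M) (D : Fin m → Module.End K M) (s : K)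
    (h : ∀ i, N * D i = D i * N + s • D i) {c : K} {x : M} (hx : N x = c • x) :
    N ((List.ofFn D).prod x) = (c + m * s) • (List.ofFn D).prod x := by
  induction m with
  | zero => simp [hx]
  | succ m ih =>
    rw [List.ofFn_succ, List.prod_cons, Module.End.mul_apply]
    set y := (List.ofFn fun i => D (Fin.succ i)).prod x with hy
    have h1 : N (D 0 y) = (N * D 0) y := rfl
    rw [h1, h 0, LinearMap.add_apply, Module.End.mul_apply, LinearMap.smul_apply,
      ih (fun i => D i.succ) fun i => h i.succ, map_smul, ← add_smul]
    congr 1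
    push_cast
    ring

/-! ### Successive moves into one row; contraction operators -/

section Rows

variable {K : Type*} [Field K] {R C : Type*} [LinearOrder R] [LinearOrder C] [Fintype C]

theorem eq_zero_of_prod_rowMove_eq_zero [CharZero K] [Finite R] {m : ℕ} (o : R) (r : Fin m → R)
    (hr : Function.Injective r) (ho : ∀ i, r i ≠ o) {a : ℕ} {b : Fin m → ℕ}
    (hb : ∀ i, a + (i.rev : ℕ) < b i) {x : Finset (R ×ₗ C) → K}
    (hxo : rowMove K o o x = (a : K) • x) (hxr : ∀ i, rowMove K (r i) (r i) x = (b i : K) • x)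
    (hx : (List.ofFn fun i => rowMove K o (r i)).prod x = 0) : x = 0 := by
  induction m with
  | zero => simpa using hx
  | succ m ih =>
    rw [List.ofFn_succ, List.prod_cons, Module.End.mul_apply] at hx
    -- The leftmost factor acts last. By then row `o` has gained `m` particles while row `r 0` is
    -- untouched, so the weights compared are `a + m` and `b 0`.
    refine ih (fun i => r i.succ) (hr.comp (Fin.succ_injective m)) (fun i => ho _)
      (b := fun i => b i.succ) (fun i => ?_) (fun i => hxr _) ?_
    · have := hb i.succ
      simp only [Fin.val_rev, Fin.val_succ] at this ⊢
      omega
    · have hab : a + m < b 0 := by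
        have := hb 0
        simpa using this
      refine eq_zero_of_rowMove_eq_zero (ho 0).symm hab ?_ ?_ hx
      · have := apply_prod_ofFn_of_commutator (rowMove K o o)
          (fun i : Fin m => rowMove K (C := C) o (r i.succ)) 1 (fun i => ?_) hxo
        · simpa using this
        · rw [rowMove_commutator]
          simp [ho]
      · have := apply_prod_ofFn_of_commutator (rowMove K (r 0) (r 0))
          (fun i : Fin m => rowMove K (C := C) o (r i.succ)) 0 (fun i => ?_) (hxr 0)
        · simpa using this
        · have h1 : r i.succ ≠ r 0 := fun h => Fin.succ_ne_zero i (hr h)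
          rw [rowMove_commutator]
          simp [ho, h1]

variable (K) in
/-- The annihilation operator of a vector placed in row `p`. -/
def rowAnnih (p : R) : (C → K) →ₗ[K] Module.End K (Finset (R ×ₗ C) → K) :=
  Fintype.linearCombination K fun i => annih K (toLex (p, i))

theorem rowAnnih_apply (p : R) (v : C → K) :
    rowAnnih K p v = ∑ i, v i • annih K (toLex (p, i)) :=
  Fintype.linearCombination_apply ..

theorem rowAnnih_single (p : R) (i : C) :
    rowAnnih K p (Pi.single i 1) = annih K (toLex (p, i)) := by
  rw [rowAnnih, Fintype.linearCombination_apply_single, one_smul]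

theorem rowAnnih_mul_rowAnnih (p q : R) (v w : C → K) :
    rowAnnih K p v * rowAnnih K q w = -(rowAnnih K q w * rowAnnih K p v) := by
  simp only [rowAnnih_apply, Finset.sum_mul_sum]
  rw [Finset.sum_comm, ← Finset.sum_neg_distrib]
  refine Finset.sum_congr rfl fun i _ => ?_
  rw [← Finset.sum_neg_distrib]
  refine Finset.sum_congr rfl fun j _ => ?_
  rw [smul_mul_smul_comm, smul_mul_smul_comm, annih_mul_annih, smul_neg, mul_comm (v j)]

theorem rowAnnih_mul_create (p q : R) (v : C → K) (i : C) :
    rowAnnih K p v * create K (toLex (q, i)) =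
      (if p = q then v i else 0) • (1 : Module.End K (Finset (R ×ₗ C) → K)) -
        create K (toLex (q, i)) * rowAnnih K p v := by
  simp only [rowAnnih_apply, Finset.sum_mul, Finset.mul_sum, smul_mul_assoc, annih_mul_create,
    mul_smul_comm, smul_sub, Finset.sum_sub_distrib]
  congr 1
  split_ifs with h
  · simp [h]
  · simp [h]

end Rows

/-! ### The flattening of the determinant as a product of row moves -/

section Flattening

variable (K : Type*) [Field K] (n : ℕ)

/-- The iterated Koszul flattening: `v₁ ⊗ ⋯ ⊗ vₙ` acts on the Fock space of the
`(n + 1) × n`-array by contracting row `p` with `v_p`; row `0` is not touched. -/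
def koszulFlattening : (⨂[K] _j : Fin n, (Fin n → K)) →ₗ[K]
    Module.End K (Finset (Fin (n + 1) ×ₗ Fin n) → K) :=
  PiTensorProduct.lift ((MultilinearMap.mkPiAlgebraFin K n
    (Module.End K (Finset (Fin (n + 1) ×ₗ Fin n) → K))).compLinearMap
      fun p => rowAnnih K p.succ)

variable {K n}

theorem koszulFlattening_tprod (v : Fin n → Fin n → K) :
    koszulFlattening K n (PiTensorProduct.tprod K v) =
      (List.ofFn fun p => rowAnnih K p.succ (v p)).prod := by
  simp [koszulFlattening, PiTensorProduct.lift.tprod]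

theorem koszulFlattening_detTensor :
    koszulFlattening K n (detTensor K n) = ∑ σ : Equiv.Perm (Fin n),
      ((Equiv.Perm.sign σ : ℤ) : K) • (List.ofFn fun p => annih K (toLex (p.succ, σ p))).prod := by
  simp [detTensor, koszulFlattening_tprod, rowAnnih_single]

/-- Expand the product over all choices of columns `r` and sort creations to the left. The creations
lie in one row, so their product alternates in `r`: repeated columns vanish, and a permutation
contributes its sign, which is the coefficient in the determinant. -/
theorem prod_rowMove_eq [CharZero K] :
    (List.ofFn fun p : Fin n => rowMove K (C := Fin n) 0 p.succ).prod =
      (-1) ^ (n.choose 2) * ((List.ofFn fun p : Fin n => create K (toLex (0, p))).prod *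
        koszulFlattening K n (detTensor K n)) := by
  obtain ⟨f, hf⟩ := exists_alternatingMap_prod (K := K)
    (fun i : Fin n => create K (toLex ((0 : Fin (n + 1)), i))) fun i j => create_mul_create _ _
  have h1 (r : Fin n → Fin n) : (List.ofFn fun p => create K (toLex ((0 : Fin (n + 1)), r p)) *
      annih K (toLex (p.succ, r p))).prod =
      (-1) ^ (n.choose 2) * (f (fun p => Pi.single (r p) 1) *
        (List.ofFn fun p : Fin n => annih K (toLex (p.succ, r p))).prod) := by
    rw [hf]
    refine prod_ofFn_mul _ _ fun i j => ?_
    rw [annih_mul_create]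
    simp
  have h2 := (MultilinearMap.mkPiAlgebraFin K n
    (Module.End K (Finset (Fin (n + 1) ×ₗ Fin n) → K))).map_sum
      fun p i => create K (toLex ((0 : Fin (n + 1)), i)) * annih K (toLex (p.succ, i))
  simp only [MultilinearMap.mkPiAlgebraFin_apply] at h2
  have h3 : f (fun p => Pi.single p 1) =
      (List.ofFn fun p : Fin n => create K (toLex ((0 : Fin (n + 1)), p))).prod := hf id
  simp only [rowMove]
  rw [h2]
  simp only [h1]
  rw [sum_perm_eq_sum_of_not_bijective, koszulFlattening_detTensor, ← h3]
  · simp only [Finset.mul_sum]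
    refine Finset.sum_congr rfl fun σ _ => ?_
    have h4 := f.map_perm (fun p => Pi.single p 1) σ
    have h5 : (fun p => Pi.single p (1 : K)) ∘ σ = fun p : Fin n => Pi.single (σ p) (1 : K) := rfl
    rw [← h5, h4, units_smul_mul K, mul_smul_comm, mul_smul_comm,
      mul_smul_comm]
  · intro r hr
    rw [← Finite.injective_iff_bijective] at hr
    simp only [Function.Injective, not_forall] at hr
    obtain ⟨i, j, hij, hne⟩ := hr
    rw [f.map_eq_zero_of_eq _ (i := i) (j := j) (by rw [hij]) hne]
    simp

end Flattening

/-! ### Dimensions by counting cell configurations -/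

theorem finrank_supported {K ι : Type*} [Field K] [Fintype ι] (s : Finset ι)
    (W : Submodule K (ι → K)) (hW : ∀ x, x ∈ W ↔ ∀ i, i ∉ s → x i = 0) :
    Module.finrank K W = s.card := by
  classical
  have h : W = ⨅ i ∈ ((s : Set ι)ᶜ), LinearMap.ker (LinearMap.proj i : (ι → K) →ₗ[K] K) := by
    ext x
    simp [hW]
  rw [h, (LinearMap.iInfKerProjEquiv K (fun _ : ι => K) (I := (s : Set ι)) disjoint_compl_right
    (by simp)).finrank_eq, Module.finrank_fintype_fun_eq_card]
  simp

/-- The cells of `S` in row `p`. -/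
def rowOf {R C : Type*} [LinearOrder R] [LinearOrder C] [Fintype C] (S : Finset (R ×ₗ C)) (p : R) :
    Finset C :=
  Finset.univ.filter fun i => toLex (p, i) ∈ S

theorem card_filter_rowOf_mem {R C : Type*} [LinearOrder R] [LinearOrder C] [Fintype R] [Fintype C]
    (t : R → Finset (Finset C))
    [DecidablePred fun S : Finset (R ×ₗ C) => ∀ p, rowOf S p ∈ t p] :
    (Finset.univ.filter fun S : Finset (R ×ₗ C) => ∀ p, rowOf S p ∈ t p).card =
      ∏ p, (t p).card := by
  rw [← Fintype.card_piFinset]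
  refine Finset.card_nbij' rowOf
    (fun f => Finset.univ.filter fun z => (ofLex z).2 ∈ f (ofLex z).1) ?_ ?_ ?_ ?_
  · intro S hS
    simpa using hS
  · intro f hf
    refine Finset.mem_coe.2 (Finset.mem_filter.2 ⟨Finset.mem_univ _, fun p => ?_⟩)
    have h : rowOf (Finset.univ.filter fun z : R ×ₗ C => (ofLex z).2 ∈ f (ofLex z).1) p = f p := by
      ext i
      simp [rowOf]
    rw [h]
    exact Fintype.mem_piFinset.1 hf p
  · intro S _
    ext z
    simp [rowOf]
  · intro f _
    ext p i
    simp [rowOf]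

/-! ### Injectivity for the determinant, rank bound for decomposables -/

section FlagSpace

variable (K : Type*) [Field K] (n : ℕ)

/-- The number of particles in each row: none in row `0`, and `n, n - 1, …, 1` in the others. -/
def flagWeight : Fin (n + 1) → ℕ := Fin.cons 0 fun p => (p.rev : ℕ) + 1

/-- The subspace `⋀⁰ ⊗ ⋀ⁿ ⊗ ⋀ⁿ⁻¹ ⊗ ⋯ ⊗ ⋀¹` of the Fock space. -/
def flagSpace : Submodule K (Finset (Fin (n + 1) ×ₗ Fin n) → K) where
  carrier := {x | ∀ p, rowMove K p p x = (flagWeight n p : K) • x}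
  add_mem' hx hy p := by rw [map_add, hx p, hy p, smul_add]
  zero_mem' p := by simp
  smul_mem' c x hx p := by rw [map_smul, hx p, smul_comm]

variable {K n}

variable [CharZero K]

theorem eq_zero_of_koszulFlattening_detTensor {x : Finset (Fin (n + 1) ×ₗ Fin n) → K}
    (hx : x ∈ flagSpace K n) (h : koszulFlattening K n (detTensor K n) x = 0) : x = 0 := by
  refine eq_zero_of_prod_rowMove_eq_zero (0 : Fin (n + 1)) Fin.succ (Fin.succ_injective n)
    Fin.succ_ne_zero (a := 0) (b := fun p => (p.rev : ℕ) + 1) (fun i => by omega) ?_ ?_ ?_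
  · simpa [flagWeight] using hx 0
  · intro i
    simpa [flagWeight] using hx i.succ
  · rw [prod_rowMove_eq, Module.End.mul_apply, Module.End.mul_apply, h]
    simp

theorem mem_flagSpace_iff_support {x : Finset (Fin (n + 1) ×ₗ Fin n) → K} :
    x ∈ flagSpace K n ↔ ∀ S, (¬ ∀ p, (rowOf S p).card = flagWeight n p) → x S = 0 := by
  constructor
  · intro hx S hS
    push Not at hS
    obtain ⟨p, hp⟩ := hS
    have h := congrFun (hx p) S
    rw [rowMove_self_apply, Pi.smul_apply, smul_eq_mul] at h
    by_contra hne
    exact hp (by exact_mod_cast mul_right_cancel₀ hne h)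
  · intro hx p
    ext S
    rw [rowMove_self_apply, Pi.smul_apply, smul_eq_mul]
    by_cases hS : ∀ p, (rowOf S p).card = flagWeight n p
    · rw [← hS p]; rfl
    · rw [hx S hS, mul_zero, mul_zero]

theorem finrank_flagSpace :
    Module.finrank K (flagSpace K n) = ∏ p : Fin n, n.choose (p.rev + 1) := by
  rw [finrank_supported (Finset.univ.filter fun S : Finset (Fin (n + 1) ×ₗ Fin n) => ∀ p,
    rowOf S p ∈ Finset.powersetCard (flagWeight n p) Finset.univ) (flagSpace K n),
    card_filter_rowOf_mem, Fin.prod_univ_succ]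
  · simp [flagWeight]
  · intro x
    rw [mem_flagSpace_iff_support]
    simp

theorem rowAnnih_mul_create_mul_rowAnnih {p : Fin (n + 1)} (i : Fin n) (v : Fin n → K) :
    rowAnnih K p v * (create K (toLex (p, i)) * rowAnnih K p v) = v i • rowAnnih K p v := by
  refine mul_mul_self_of_anticommutator ?_
    (mul_self_eq_zero_of_anticommute K (rowAnnih_mul_rowAnnih p p v v))
  rw [rowAnnih_mul_create, if_pos rfl]

/-- If some `v p` is zero, so is the map. Otherwise pick `i p` with `v p (i p) ≠ 0`. Precomposing
with `Q`, which refills the cells `i p` after contraction, only rescales the flattening. The image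
of the flag space is therefore already reached from the vectors supported on configurations
containing all these cells. -/
theorem finrank_map_koszulFlattening_tprod_le (v : Fin n → Fin n → K) :
    Module.finrank K ((flagSpace K n).map (koszulFlattening K n (PiTensorProduct.tprod K v))) ≤
      ∏ p : Fin n, (n - 1).choose p.rev := by
  by_cases hv : ∃ p, v p = 0
  · obtain ⟨p, hp⟩ := hv
    rw [(PiTensorProduct.tprod K).map_coord_zero p hp, map_zero, Submodule.map_zero]
    simp
  have hv' (p : Fin n) : ∃ i, v p i ≠ 0 := by
    by_contra! h
    exact hv ⟨p, funext h⟩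
  choose i hi using hv'
  set a : Fin n → Module.End K (Finset (Fin (n + 1) ×ₗ Fin n) → K) :=
    fun p => rowAnnih K p.succ (v p) with ha
  set c : Fin n → Module.End K (Finset (Fin (n + 1) ×ₗ Fin n) → K) :=
    fun p => create K (toLex (p.succ, i p)) with hc
  set Q := (List.ofFn fun p => c p * a p).prod with hQ
  have hac (p q : Fin n) (hpq : p ≠ q) : c q * a p = -(a p * c q) := by
    rw [ha, hc, rowAnnih_mul_create, if_neg (by simpa using hpq)]
    simp
  have hGQ : (List.ofFn a).prod * Q = (∏ p, v p (i p)) • (List.ofFn a).prod := by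
    refine prod_ofFn_mul_prod_ofFn c a _ (fun p q hpq => ?_) fun p =>
      rowAnnih_mul_create_mul_rowAnnih _ _
    exact commute_mul_of_anticommute (hac q p hpq.symm) (rowAnnih_mul_rowAnnih _ _ _ _)
  have hN (q : Fin (n + 1)) : Commute (rowMove K q q) Q := by
    refine Commute.list_prod_right _ _ fun x hx => ?_
    obtain ⟨p, rfl⟩ := (List.mem_ofFn' _ _).1 hx
    simp only [hc, ha, rowAnnih_apply, Finset.mul_sum, mul_smul_comm]
    refine Commute.sum_right _ _ _ fun j _ => Commute.smul_right ?_ _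
    exact rowMove_self_mul_create_mul_annih _ _ _ _
  have hcQ (p : Fin n) : c p * Q = 0 := by
    have hpp : c p * (c p * a p) = 0 := by
      rw [← mul_assoc, mul_self_eq_zero_of_anticommute K (create_mul_create _ _), zero_mul]
    refine mul_list_prod_eq_zero _ _ (fun y hy => ?_)
      ⟨c p * a p, (List.mem_ofFn' _ _).2 ⟨p, rfl⟩, hpp⟩
    obtain ⟨q, rfl⟩ := (List.mem_ofFn' _ _).1 hy
    rcases eq_or_ne p q with rfl | hpq
    · exact Or.inr hpp
    · refine Or.inl (commute_mul_of_anticommute (create_mul_create _ _) ?_).symm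
      rw [hac q p hpq.symm]
      exact (neg_neg _).symm
  -- Being killed by `c p` means being supported where cell `i p` of row `p.succ` is occupied, which
  -- leaves `p.rev` of the other `n - 1` cells to choose.
  let Y : Submodule K (Finset (Fin (n + 1) ×ₗ Fin n) → K) :=
    flagSpace K n ⊓ ⨅ p, LinearMap.ker (c p)
  have hY : Module.finrank K Y = ∏ p : Fin n, (n - 1).choose p.rev := by
    rw [finrank_supported (Finset.univ.filter fun S : Finset (Fin (n + 1) ×ₗ Fin n) => ∀ p,
      rowOf S p ∈ (Fin.cons {∅} (fun p => (Finset.powersetCard (p.rev + 1) Finset.univ).filter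
        ({i p} ⊆ ·)) : Fin (n + 1) → Finset (Finset (Fin n))) p) Y,
      card_filter_rowOf_mem, Fin.prod_univ_succ]
    · simp only [Fin.cons_zero, Fin.cons_succ, Finset.card_singleton, one_mul]
      refine Finset.prod_congr rfl fun p _ => ?_
      rw [Finset.card_filter_powersetCard_subset _ _ _ (Finset.subset_univ _) (by simp)]
      simp
    · intro x
      simp only [Y, Submodule.mem_inf, mem_flagSpace_iff_support, Submodule.mem_iInf,
        LinearMap.mem_ker, hc, create_apply_eq_zero_iff, Finset.mem_filter, Finset.mem_univ,
        true_and, Fin.forall_fin_succ, Fin.cons_zero, Fin.cons_succ, flagWeight,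
        Finset.mem_singleton, Finset.mem_powersetCard, Finset.subset_univ, Finset.card_eq_zero,
        Finset.singleton_subset_iff]
      constructor
      · rintro ⟨h1, h2⟩ S hS
        by_cases h : ∀ p, toLex (p.succ, i p) ∈ S
        · refine h1 S fun h' => hS ⟨h'.1, fun p => ⟨h'.2 p, ?_⟩⟩
          simpa [rowOf] using h p
        · push Not at h
          obtain ⟨p, hp⟩ := h
          exact h2 p S hp
      · intro h
        refine ⟨fun S hS => h S fun h' => hS ⟨h'.1, fun p => (h'.2 p).1⟩,
          fun p S hS => h S fun h' => hS ?_⟩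
        simpa [rowOf] using (h'.2 p).2
  rw [koszulFlattening_tprod, ← hY]
  refine le_trans (Submodule.finrank_mono (t := Y.map (List.ofFn a).prod) ?_)
    (Submodule.finrank_map_le _ _)
  rintro _ ⟨x, hx, rfl⟩
  have ht : (∏ p, v p (i p)) ≠ 0 := Finset.prod_ne_zero_iff.2 fun p _ => hi p
  refine ⟨(∏ p, v p (i p))⁻¹ • Q x, Y.smul_mem _ ⟨fun q => ?_, ?_⟩, ?_⟩
  · have := LinearMap.congr_fun (hN q).eq x
    rw [Module.End.mul_apply, Module.End.mul_apply, hx q, map_smul] at this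
    exact this
  · simp only [SetLike.mem_coe, Submodule.mem_iInf, LinearMap.mem_ker]
    intro p
    exact LinearMap.congr_fun (hcQ p) x
  · have := LinearMap.congr_fun hGQ x
    rw [Module.End.mul_apply, LinearMap.smul_apply] at this
    rw [map_smul, this, smul_smul, inv_mul_cancel₀ ht, one_smul]

end FlagSpace

/-! ### From injectivity to the border rank bound -/

/-- Injectivity of a linear map depending linearly on a parameter is a Zariski open condition. -/
theorem exists_injective_of_mem_zariskiClosure {K W X Y : Type*} [Field K] [AddCommGroup W]
    [Module K W] [AddCommGroup X] [Module K X] [FiniteDimensional K X] [AddCommGroup Y] [Module K Y]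
    (L : W →ₗ[K] X →ₗ[K] Y) {Z : Set W} {w : W} (hw : w ∈ zariskiClosure (K := K) Z)
    (hL : Function.Injective (L w)) :
    ∃ z ∈ Z, Function.Injective (L z) := by
  by_contra! hZ
  obtain ⟨g, hg⟩ := (L w).exists_leftInverse_of_injective (LinearMap.ker_eq_bot.2 hL)
  let b := Module.finBasis K X
  let F (i j : Fin (Module.finrank K X)) : Module.Dual K W :=
    b.coord i ∘ₗ g ∘ₗ L.flip (b j)
  -- This polynomial is z ↦ det(g ∘ L z): it is 1 at `w`, since `g` is a left inverse of `L w`, and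
  -- 0 wherever `L z` is not injective.
  let p : MvPolynomial (Module.Dual K W) K := (Matrix.of fun i j => MvPolynomial.X (F i j)).det
  have hp (z : W) : MvPolynomial.eval (fun f : Module.Dual K W => f z) p =
      LinearMap.det (g ∘ₗ L z) := by
    rw [← LinearMap.det_toMatrix b, RingHom.map_det]
    congr 1
    ext i j
    simp [F, LinearMap.toMatrix_apply]
  have h := hw p fun z hz => by
    rw [hp]
    by_contra hne
    have hu : IsUnit (LinearMap.det (g ∘ₗ L z)) := isUnit_iff_ne_zero.2 hne
    have hinj : Function.Injective (g ∘ₗ L z) :=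
      (LinearEquiv.ofIsUnitDet (f := g ∘ₗ L z) (v := b) (v' := b)
        (by rwa [LinearMap.det_toMatrix])).injective
    exact hZ z hz (Function.Injective.of_comp (f := g) hinj)
  rw [hp, hg, LinearMap.det_id] at h
  exact one_ne_zero h

theorem finrank_map_sum_le {K ι X Y : Type*} [Field K] [AddCommGroup X] [Module K X]
    [AddCommGroup Y] [Module K Y] [FiniteDimensional K Y] (P : Submodule K X) (s : Finset ι)
    (f : ι → X →ₗ[K] Y) (y : ℕ) (h : ∀ i ∈ s, Module.finrank K (P.map (f i)) ≤ y) :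
    Module.finrank K (P.map (∑ i ∈ s, f i)) ≤ s.card * y := by
  classical
  induction s using Finset.induction_on with
  | empty => rw [Finset.sum_empty, Submodule.map_zero]; simp
  | insert i s hi ih =>
    rw [Finset.sum_insert hi, Finset.card_insert_of_notMem hi, add_mul, one_mul,
      add_comm (s.card * y)]
    refine (Submodule.finrank_mono (Submodule.map_add_le P _ _)).trans
      ((Submodule.finrank_add_le_finrank_add_finrank _ _).trans (Nat.add_le_add ?_ ?_))
    · exact h i (Finset.mem_insert_self i s)
    · exact ih fun j hj => h j (Finset.mem_insert_of_mem hj)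

theorem finrank_map_of_injective_comp_subtype {K X Y : Type*} [Field K] [AddCommGroup X]
    [Module K X] [AddCommGroup Y] [Module K Y] {P : Submodule K X} {f : X →ₗ[K] Y}
    (h : Function.Injective (f ∘ₗ P.subtype)) :
    Module.finrank K (P.map f) = Module.finrank K P := by
  rw [← LinearMap.finrank_range_of_inj h, LinearMap.range_comp, Submodule.range_subtype]

theorem isSumOfDecomposables_tensorRank {K : Type*} [Field K] {d : ℕ} {V : Fin d → Type*}
    [∀ j, AddCommGroup (V j)] [∀ j, Module K (V j)] (hd : 1 ≤ d) (T : ⨂[K] j, V j) :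
    IsSumOfDecomposables T (tensorRank T) :=
  Nat.sInf_mem (exists_isSumOfDecomposables hd T)

theorem borderRank_le_tensorRank {K : Type*} [Field K] {d : ℕ} {V : Fin d → Type*}
    [∀ j, AddCommGroup (V j)] [∀ j, Module K (V j)] (T : ⨂[K] j, V j) :
    borderRank T ≤ tensorRank T :=
  Nat.sInf_le fun _ hp => hp T (le_refl (tensorRank T))

/-- Factor by factor this is (k+1)·C(n, k+1) = n·C(n-1, k). It identifies the ratio of the two
dimensions as nⁿ/n!. -/
theorem prod_choose_mul_factorial (n : ℕ) :
    (∏ p : Fin n, n.choose (p.rev + 1)) * n ! = n ^ n * ∏ p : Fin n, (n - 1).choose p.rev := by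
  have h1 : ∏ p : Fin n, ((p.rev : ℕ) + 1) = n ! := by
    have h := Equiv.prod_comp Fin.revPerm (fun p : Fin n => (p : ℕ) + 1)
    simp only [Fin.revPerm_apply] at h
    rw [h, Fin.prod_univ_eq_prod_range (fun p => p + 1) n, Finset.prod_range_add_one_eq_factorial]
  have h2 : n ^ n = ∏ _p : Fin n, n := by simp
  rw [← h1, h2, ← Finset.prod_mul_distrib, ← Finset.prod_mul_distrib]
  refine Finset.prod_congr rfl fun p _ => ?_
  obtain ⟨m, rfl⟩ : ∃ m, n = m + 1 := ⟨n - 1, by have := p.2; omega⟩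
  exact (Nat.add_one_mul_choose_eq m p.rev).symm

theorem pow_le_borderRank_mul_factorial (K : Type*) [Field K] [CharZero K] {n : ℕ} (hn : 1 ≤ n) :
    n ^ n ≤ borderRank (detTensor K n) * n ! := by
  have hmem : detTensor K n ∈ zariskiClosure (K := K)
      {S : ⨂[K] _j : Fin n, (Fin n → K) | tensorRank S ≤ borderRank (detTensor K n)} :=
    Nat.sInf_mem (exists_mem_zariskiClosure (detTensor K n))
  obtain ⟨S, hS, hinj⟩ := exists_injective_of_mem_zariskiClosure
    ((LinearMap.lcomp K (Finset (Fin (n + 1) ×ₗ Fin n) → K) (flagSpace K n).subtype) ∘ₗ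
      koszulFlattening K n) hmem (by
      rw [injective_iff_map_eq_zero]
      rintro ⟨x, hx⟩ h
      exact Subtype.ext (eq_zero_of_koszulFlattening_detTensor hx h))
  obtain ⟨v, hv⟩ := isSumOfDecomposables_tensorRank hn S
  have h1 : Module.finrank K ((flagSpace K n).map (koszulFlattening K n S)) =
      Module.finrank K (flagSpace K n) :=
    finrank_map_of_injective_comp_subtype hinj
  have h2 : Module.finrank K ((flagSpace K n).map (koszulFlattening K n S)) ≤
      tensorRank S * ∏ p : Fin n, (n - 1).choose p.rev := by
    have := finrank_map_sum_le (flagSpace K n) Finset.univ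
      (fun i => koszulFlattening K n (PiTensorProduct.tprod K (v i))) _
      fun i _ => finrank_map_koszulFlattening_tprod_le (v i)
    rwa [← map_sum, ← hv, Finset.card_univ, Fintype.card_fin] at this
  rw [h1, finrank_flagSpace] at h2
  have hpos : 0 < ∏ p : Fin n, (n - 1).choose p.rev :=
    Finset.prod_pos fun p _ => Nat.choose_pos (by have := p.rev.2; omega)
  refine Nat.le_of_mul_le_mul_right ?_ hpos
  calc n ^ n * ∏ p : Fin n, (n - 1).choose p.rev
      = (∏ p : Fin n, n.choose (p.rev + 1)) * n ! := (prod_choose_mul_factorial n).symm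
    _ ≤ (borderRank (detTensor K n) * ∏ p : Fin n, (n - 1).choose p.rev) * n ! :=
        Nat.mul_le_mul_right _ (h2.trans (Nat.mul_le_mul_right _ hS))
    _ = _ := by ring

/-! ### Glynn's formula and the rank of the permanent -/

theorem sum_units_int_pow (K : Type*) [Field K] (e : ℕ) :
    ∑ s : ℤˣ, (((s : ℤ) : K)) ^ e = if Even e then 2 else 0 := by
  have : (Finset.univ : Finset ℤˣ) = {1, -1} := rfl
  rw [this, Finset.sum_pair (by decide)]
  split_ifs with h
  · simp [h.neg_pow]; norm_num
  · simp [(Nat.not_even_iff_odd.1 h).neg_pow]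

/-- The sign vectors of length `m + 1` with first entry `1`. -/
def signVector (K : Type*) [Field K] {m : ℕ} (s : Fin m → ℤˣ) : Fin (m + 1) → K :=
  Fin.cons 1 fun k => ((s k : ℤ) : K)

/-- The fibre sizes add up to m + 1 and `m` of them are odd, so the fibre over 0 is odd as well.
Hence no fibre is empty. -/
theorem bijective_of_odd_card_fiber {m : ℕ} {r : Fin (m + 1) → Fin (m + 1)}
    (h : ∀ k : Fin m, Odd (Finset.univ.filter fun j => r j = k.succ).card) :
    Function.Bijective r := by
  rw [← Finite.surjective_iff_bijective]
  have hsum : ∑ k, (Finset.univ.filter fun j => r j = k).card = m + 1 := by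
    have := Finset.card_eq_sum_card_fiberwise (f := r) (s := Finset.univ) (t := Finset.univ)
      (by simp)
    simpa using this.symm
  rw [Fin.sum_univ_succ] at hsum
  have h0 : Odd (Finset.univ.filter fun j => r j = 0).card := by
    have hmod : (∑ k : Fin m, (Finset.univ.filter fun j => r j = k.succ).card) % 2 = m % 2 := by
      rw [Finset.sum_nat_mod, Finset.sum_congr rfl fun k _ => Nat.odd_iff.1 (h k)]
      simp
    rw [Nat.odd_iff]
    omega
  intro k
  have hk : Odd (Finset.univ.filter fun j => r j = k).card := by
    rcases Fin.eq_zero_or_eq_succ k with rfl | ⟨k, rfl⟩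
    · exact h0
    · exact h k
  obtain ⟨j, hj⟩ := Finset.card_pos.1 hk.pos
  exact ⟨j, (Finset.mem_filter.1 hj).2⟩

/-- The sum factors over the signs; the `k`-th sign has exponent one plus the size of the fibre over
`k.succ`, so an even fibre there gives a zero factor. -/
theorem sum_signVector_prod (K : Type*) [Field K] {m : ℕ} (r : Fin (m + 1) → Fin (m + 1)) :
    ∑ s : Fin m → ℤˣ, (∏ k, signVector K s k) * ∏ j, signVector K s (r j) =
      if Function.Bijective r then 2 ^ m else 0 := by
  have h1 (s : Fin m → ℤˣ) : (∏ k, signVector K s k) * ∏ j, signVector K s (r j) =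
      ∏ k : Fin m, ((s k : ℤ) : K) ^ (1 + (Finset.univ.filter fun j => r j = k.succ).card) := by
    have : ∏ j, signVector K s (r j) =
        ∏ k, signVector K s k ^ (Finset.univ.filter fun j => r j = k).card := by
      rw [← Finset.prod_fiberwise_of_maps_to (s := Finset.univ) (t := Finset.univ) (g := r)
        (by simp)]
      exact Finset.prod_congr rfl fun k _ =>
        Finset.prod_eq_pow_card fun j hj => by rw [(Finset.mem_filter.1 hj).2]
    rw [this, Fin.prod_univ_succ, Fin.prod_univ_succ]
    simp only [signVector, Fin.cons_zero, Fin.cons_succ, one_pow, one_mul,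
      ← Finset.prod_mul_distrib, pow_add, pow_one]
  have h2 := Finset.prod_univ_sum (fun _ : Fin m => (Finset.univ : Finset ℤˣ))
    fun k s => ((s : ℤ) : K) ^ (1 + (Finset.univ.filter fun j => r j = k.succ).card)
  rw [Fintype.piFinset_univ] at h2
  simp only [h1]
  rw [← h2]
  simp only [sum_units_int_pow]
  split_ifs with hr
  · have hc (k : Fin m) : (Finset.univ.filter fun j => r j = k.succ).card = 1 := by
      obtain ⟨j, hj, huniq⟩ := hr.existsUnique k.succ
      exact Finset.card_eq_one.2 ⟨j, by ext i; simp only [Finset.mem_filter, Finset.mem_univ,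
        true_and, Finset.mem_singleton]; exact ⟨huniq i, fun h => h ▸ hj⟩⟩
    simp [hc]
  · have : ∃ k : Fin m, ¬ Odd (Finset.univ.filter fun j => r j = k.succ).card := by
      by_contra! h
      exact hr (bijective_of_odd_card_fiber h)
    obtain ⟨k, hk⟩ := this
    refine Finset.prod_eq_zero (Finset.mem_univ k) (if_neg ?_)
    rw [add_comm, Nat.even_add_one, Nat.not_even_iff_odd]
    exact hk

/-- Glynn's formula for the permanent. -/
theorem two_pow_smul_permTensor (K : Type*) [Field K] (m : ℕ) :
    (2 : K) ^ m • permTensor K (m + 1) = ∑ s : Fin m → ℤˣ,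
      (∏ k, signVector K s k) • PiTensorProduct.tprod K fun _ : Fin (m + 1) => signVector K s := by
  have h1 (s : Fin m → ℤˣ) : (PiTensorProduct.tprod K fun _ : Fin (m + 1) => signVector K s) =
      ∑ r : Fin (m + 1) → Fin (m + 1), (∏ j, signVector K s (r j)) •
        PiTensorProduct.tprod K fun j => (Pi.single (r j) 1 : Fin (m + 1) → K) := by
    have h2 : signVector K s = ∑ k, signVector K s k • (Pi.single k 1 : Fin (m + 1) → K) :=
      pi_eq_sum_univ' _
    conv_lhs => rw [h2]
    rw [MultilinearMap.map_sum]
    exact Finset.sum_congr rfl fun r _ => MultilinearMap.map_smul_univ _ _ _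
  simp only [h1, Finset.smul_sum, smul_smul]
  rw [Finset.sum_comm]
  simp only [← Finset.sum_smul, sum_signVector_prod]
  rw [sum_perm_eq_sum_of_not_bijective _ fun r hr => by rw [if_neg hr, zero_smul], permTensor,
    Finset.smul_sum]
  exact Finset.sum_congr rfl fun σ _ => by rw [if_pos σ.bijective]

theorem tensorRank_permTensor_le (K : Type*) [Field K] [CharZero K] (m : ℕ) :
    tensorRank (permTensor K (m + 1)) ≤ 2 ^ m := by
  have hcard : Fintype.card (Fin m → ℤˣ) = 2 ^ m := by simp
  let e : Fin (2 ^ m) ≃ (Fin m → ℤˣ) := (Fintype.equivFinOfCardEq hcard).symm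
  -- The scalar coefficient of each summand is absorbed into its first tensor factor.
  refine Nat.sInf_le ⟨fun i => Function.update (fun _ => signVector K (e i)) 0
    ((((2 : K) ^ m)⁻¹ * ∏ k, signVector K (e i) k) • signVector K (e i)), ?_⟩
  have h2 : ((2 : K) ^ m) ≠ 0 := pow_ne_zero _ two_ne_zero
  rw [← inv_smul_smul₀ h2 (permTensor K (m + 1)), two_pow_smul_permTensor, Finset.smul_sum,
    ← e.sum_comp]
  refine Finset.sum_congr rfl fun i _ => ?_
  rw [MultilinearMap.map_update_smul, smul_smul]
  congr 1
  exact congrArg _ (Function.update_eq_self (0 : Fin (m + 1)) fun _ => signVector K (e i)).symm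

theorem two_pow_mul_factorial_lt {m : ℕ} (hm : 2 ≤ m) : 2 ^ m * m ! < (m + 1) ^ m := by
  induction m, hm using Nat.le_induction with
  | base => decide
  | succ m hm ih =>
    have h : 2 * (m + 1) ^ (m + 1) ≤ (m + 1 + 1) ^ (m + 1) := by
      -- The two top terms of the binomial expansion each equal (m+1)^(m+1).
      rw [add_pow (m + 1) 1 (m + 1), Finset.sum_range_succ, Finset.sum_range_succ]
      simp
      ring_nf
      omega
    calc 2 ^ (m + 1) * (m + 1)! = 2 * (m + 1) * (2 ^ m * m !) := by
          rw [Nat.factorial_succ]; ring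
      _ < 2 * (m + 1) * (m + 1) ^ m := Nat.mul_lt_mul_of_pos_left ih (by positivity)
      _ = 2 * (m + 1) ^ (m + 1) := by ring
      _ ≤ _ := h

end TensorRank

end

theorem theorem4p2 (K : Type*) [Field K] [CharZero K] (n : ℕ) (hn : 1 ≤ n) :
    ((n : ℚ) ^ (n - 1) / ((n - 1)! : ℕ) ≤ TensorRank.borderRank (TensorRank.detTensor K n)) ∧
    (3 ≤ n →
      TensorRank.tensorRank (TensorRank.permTensor K n) ≤ 2 ^ (n - 1) ∧
      (2 : ℚ) ^ (n - 1) < (n : ℚ) ^ (n - 1) / ((n - 1)! : ℕ) ∧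
      TensorRank.borderRank (TensorRank.detTensor K n) ≤
        TensorRank.tensorRank (TensorRank.detTensor K n) ∧
      TensorRank.tensorRank (TensorRank.permTensor K n) <
        TensorRank.tensorRank (TensorRank.detTensor K n)) := by
  obtain ⟨m, rfl⟩ : ∃ m, n = m + 1 := ⟨n - 1, by omega⟩
  have hfac : (0 : ℚ) < (m ! : ℕ) := by exact_mod_cast m.factorial_pos
  have hborder : (m + 1) ^ m ≤
      TensorRank.borderRank (TensorRank.detTensor K (m + 1)) * m ! := by
    have h := TensorRank.pow_le_borderRank_mul_factorial K hn
    -- A common factor m + 1 cancels from nⁿ and n!.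
    rw [pow_succ, Nat.factorial_succ, mul_comm (m + 1), ← mul_assoc] at h
    exact Nat.le_of_mul_le_mul_right h m.succ_pos
  have hlower : ((m + 1 : ℕ) : ℚ) ^ m / (m ! : ℕ) ≤
      TensorRank.borderRank (TensorRank.detTensor K (m + 1)) := by
    rw [div_le_iff₀ hfac]
    exact_mod_cast hborder
  simp only [Nat.add_sub_cancel]
  refine ⟨hlower, fun hm => ?_⟩
  have hperm := TensorRank.tensorRank_permTensor_le K m
  have hle := TensorRank.borderRank_le_tensorRank (TensorRank.detTensor K (m + 1))
  have hlt : (2 : ℚ) ^ m < ((m + 1 : ℕ) : ℚ) ^ m / (m ! : ℕ) := by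
    rw [lt_div_iff₀ hfac]
    exact_mod_cast TensorRank.two_pow_mul_factorial_lt (by omega : 2 ≤ m)
  refine ⟨hperm, hlt, hle, ?_⟩
  have hlt' : 2 ^ m < TensorRank.borderRank (TensorRank.detTensor K (m + 1)) := by
    exact_mod_cast hlt.trans_le hlower
  omega
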